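/- Let $0\le k\le n$ and let $X$ be the set of words of length $n$ in the alphabet $\{1,2\}$ in which the letter $1$ occurs exactly $k$ times (equivalently, the $k$-subsets of $\{1,\dots,n\}$). Let $\mathcal F$ be the space of complex functions on $X$, with the inner product for which the delta functions are orthonormal and with the action $\sigma f=f\circ\sigma^{-1}$ of $S_n$, which permutes the places of the words. For $0\le j\le n$ let $S_j\subseteq S_n$ be the subgroup fixing $j+1,\dots,n$, and for an (isomorphism class of an) irreducible complex representation $\lambda$ of $S_j$ let $\mathcal F_{j,\lambda}$ be the $\lambda$-isotypic component of $\mathcal F$ as an $S_j$-module. For $0\le i\le n$ let $X_i$ be the set of words $w=c_{i+1}\cdots c_n$ in $\{1,2\}$ with at most $k$ letters $1$, and let $\mathcal F^w$ be the span of the delta functions at the words of $X$ that end in $w$. For $w\in X_i$ and a chain $T=(\lambda_1\nearrow\cdots\nearrow\lambda_i)$, where $\lambda_j\in\mathrm{Irr}(S_j)$ and $\lambda_j$ occurs in the restriction of $\lambda_{j+1}$ to $S_j$, put $$\mathcal F^w_T=\mathcal F_{1,\lambda_1}\cap\cdots\cap\mathcal F_{i,\lambda_i}\cap\mathcal F^w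 .$$ An $i$-th intermediate basis $B_i$ is an orthonormal basis of $\mathcal F$ each of whose elements lies in some $\mathcal F^w_T$ with $w\in X_i$ and $T$ a chain of length $i$; such a pair $(T,w)$ is called a label of the element. Let $1\le i\le n$, let $B_i$ and $B_{i-1}$ be intermediate bases, and let $b\in B_i$. Then at most two elements of $B_{i-1}$ are not orthogonal to $b$. Moreover, if $b$ has the label $(\lambda_1\nearrow\cdots\nearrow\lambda_i,\ c_{i+1}\cdots c_n)$, then every label of an element of $B_{i-1}$ not orthogonal to $b$ is of the form $(\lambda_1\nearrow\cdots\nearrow\lambda_{i-1},\ c_ic_{i+1}\cdots c_n)$ with $c_i\in\{1,2\}$, and two elements of $B_{i-1}$ not orthogonal to $b$ whose labels have the same letter $c_i$ are equal. -/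

import Mathlib

noncomputable section

namespace Johnson

/-- The alphabet `{1, 2}`. -/
inductive Letter
  | one
  | two
  deriving DecidableEq

instance : Fintype Letter := ⟨{Letter.one, Letter.two}, fun c => by cases c <;> simp⟩

/-- The set `X` of `k`-subsets of `{1, …, n}`, written as words of length `n` in which the
letter `1` occurs exactly `k` times (the place `j` carries the letter `1` iff `j` belongs to the
subset). The place `j ∈ {1, …, n}` is the element of `Fin n` of value `j - 1`. -/
abbrev X (n k : ℕ) : Type :=
  {x : Fin n → Letter // (Finset.univ.filter fun j => x j = Letter.one).card = k}

/-- The space of complex functions on `X`, with the inner product for which the delta functions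
are orthonormal. -/
abbrev F (n k : ℕ) : Type := EuclideanSpace ℂ (X n k)

/-- `σ⁻¹ x` for a permutation `σ` and a word `x`: the letter of `x` at the place `σ j` is moved
to the place `j`. -/
def permInv {n k : ℕ} (σ : Equiv.Perm (Fin n)) (x : X n k) : X n k :=
  ⟨fun j => x.1 (σ j), (Finset.card_equiv σ (by simp)).trans x.2⟩

/-- The action of `S_n` on functions, `(σ f)(x) = f (σ⁻¹ x)`. -/
def rep (n k : ℕ) : Representation ℂ (Equiv.Perm (Fin n)) (F n k) where
  toFun σ :=
    { toFun := fun f => WithLp.toLp 2 fun x => f (permInv σ x)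
      map_add' := fun _ _ => rfl
      map_smul' := fun _ _ => rfl }
  map_one' := rfl
  map_mul' _ _ := rfl

/-- The subgroup `S_i` of `S_n` of the permutations fixing the places `i + 1, …, n`. -/
def symSub (n i : ℕ) : Subgroup (Equiv.Perm (Fin n)) :=
  fixingSubgroup (Equiv.Perm (Fin n)) {j : Fin n | i ≤ (j : ℕ)}

theorem symSub_mono {n i j : ℕ} (h : i ≤ j) : symSub n i ≤ symSub n j :=
  fixingSubgroup_antitone _ _ fun _ hx => le_trans h hx

/-- The simple submodules of the regular representation of `G`, up to isomorphism. -/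
def irrSetoid (G : Type) [Group G] :
    Setoid {V : Submodule (MonoidAlgebra ℂ G) (MonoidAlgebra ℂ G) //
      IsSimpleModule (MonoidAlgebra ℂ G) V} where
  r V W := Nonempty (V.1 ≃ₗ[MonoidAlgebra ℂ G] W.1)
  iseqv :=
    { refl := fun _ => ⟨LinearEquiv.refl _ _⟩
      symm := fun ⟨e⟩ => ⟨e.symm⟩
      trans := fun ⟨e⟩ ⟨e'⟩ => ⟨e.trans e'⟩ }

/-- Equivalence classes of irreducible complex representations of a finite group `G`. Each class
has representatives among the simple submodules of the regular representation. -/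
def Irr (G : Type) [Group G] : Type := Quotient (irrSetoid G)

/-- The branching relation `μ ↗ lam` for `μ ∈ Irr(S_i)` and `lam ∈ Irr(S_{i+1})`: the
representation `μ` occurs in the restriction of `lam` to `S_i`, i.e. there is a nonzero
`S_i`-equivariant linear map `V_μ → V_lam`. -/
def Branches {n i : ℕ} (μ : Irr (symSub n i)) (lam : Irr (symSub n (i + 1))) : Prop :=
  ∃ V W, Quotient.mk (irrSetoid (symSub n i)) V = μ ∧
    Quotient.mk (irrSetoid (symSub n (i + 1))) W = lam ∧
    ∃ f : V.1 →ₗ[ℂ] W.1, f ≠ 0 ∧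
      ∀ (g : symSub n i) (v : V.1),
        f (MonoidAlgebra.of ℂ _ g • v) =
          MonoidAlgebra.of ℂ _ (Subgroup.inclusion (symSub_mono (Nat.le_succ i)) g) • f v

/-- A chain `λ_1 ↗ λ_2 ↗ ⋯ ↗ λ_i` with `λ_j ∈ Irr(S_j)`; `irr j` is `λ_{j+1}`. -/
@[ext]
structure Chain (n i : ℕ) where
  irr : ∀ j : Fin i, Irr (symSub n ((j : ℕ) + 1))
  branches : ∀ (j : ℕ) (h : j + 1 < i),
    Branches (irr ⟨j, Nat.lt_of_succ_lt h⟩) (irr ⟨j + 1, h⟩)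

/-- The chain `λ_1 ↗ ⋯ ↗ λ_i` obtained from `λ_1 ↗ ⋯ ↗ λ_i ↗ λ_{i+1}`. -/
def Chain.init {n i : ℕ} (T : Chain n (i + 1)) : Chain n i where
  irr j := T.irr j.castSucc
  branches j h := T.branches j (Nat.lt_succ_of_lt h)

/-- The function space, as a representation of `S_i`. -/
def repSub (n k i : ℕ) : Representation ℂ (symSub n i) (F n k) :=
  (rep n k).comp (symSub n i).subtype

/-- The isotypic component `F_{i,λ}` of the function space, seen as an `S_i`-module. -/
def isotypic (n k i : ℕ) (lam : Irr (symSub n i)) : Submodule ℂ (F n k) :=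
  Quotient.lift
    (fun V => ((isotypicComponent (MonoidAlgebra ℂ (symSub n i)) (repSub n k i).asModule
      V.1).restrictScalars ℂ).map ((repSub n k i).asModuleEquiv : _ →ₗ[ℂ] F n k))
    (fun _ _ h => by obtain ⟨e⟩ := h; rw [e.isotypicComponent_eq]) lam

/-- The set `X_i` of words `c_{i+1} ⋯ c_n` in which the letter `1` occurs at most `k` times. -/
abbrev Word (n k i : ℕ) : Type :=
  {w : {j : Fin n // i ≤ (j : ℕ)} → Letter //
    (Finset.univ.filter fun j => w j = Letter.one).card ≤ k}

/-- The subspace `F^w` spanned by the delta functions at the words `x ∈ X` that end in `w`. -/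
def wordSpace {n k i : ℕ} (w : Word n k i) : Submodule ℂ (F n k) :=
  Submodule.span ℂ {f | ∃ x : X n k, (∀ j, x.1 j.1 = w.1 j) ∧ f = EuclideanSpace.single x 1}

/-- The Gelfand–Tsetlin subspace `F^w_T = F_{1,λ_1} ∩ ⋯ ∩ F_{i,λ_i} ∩ F^w`
for the chain `T = (λ_1 ↗ ⋯ ↗ λ_i)`. -/
def gtSpace {n k i : ℕ} (w : Word n k i) (T : Chain n i) : Submodule ℂ (F n k) :=
  (⨅ j : Fin i, isotypic n k ((j : ℕ) + 1) (T.irr j)) ⊓ wordSpace w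

/-- `B` is an `i`-th intermediate basis: an orthonormal basis of the function space each of whose
elements lies in one of the Gelfand–Tsetlin subspaces `F^w_T`, `w ∈ X_i`. (That the nonzero
subspaces among these are lines, so that `B` is unique up to scalars, is not part of
the definition.) -/
structure IsIntermediateBasis (n k i : ℕ) (B : Set (F n k)) : Prop where
  orthonormal : Orthonormal ℂ (Subtype.val : B → F n k)
  span_eq_top : Submodule.span ℂ B = ⊤
  mem_gtSpace : ∀ b ∈ B, ∃ (w : Word n k i) (T : Chain n i), b ∈ gtSpace w T

end Johnson

end

/-!
That the labels of nonorthogonal elements are compatible is the orthogonality of distinct isotypic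
components and of distinct `F^w`. The rest follows once the spaces `F^w_T` are at most
one-dimensional.

Extended by zero to all words, functions become tensors in `(ℂ²)^{⊗ n}`. By Schur's lemma the sum of
the transpositions of `S_j` acts by a scalar on an isotypic component for `S_j`, hence the
Jucys–Murphy elements of `S_i`, being differences of such sums, act by scalars on `F^w_T`. Induct on
`i`: the two projections onto the words with a given letter `c_i` map `F^w_T` to spaces with the
same properties for `i - 1`, so it is enough that one of them is injective on `F^w_T`. Otherwise
there are nonzero `f` and `g` in `F^w_T` supported on words with `c_i = 1` and with `c_i = 2`. If
`m` is the number of letters `1` at the first `i` places, the eigenvalue `c` of the last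
Jucys–Murphy element, read off from `f`, is the number `m - 1` of letters `1` at the first `i - 1`
places. Read off from `g`, it is the number of letters `2` there, and the same equation shows that
`g` is an extreme weight vector for the action of `gl₂` on the first `i - 1` tensor factors. This
forces `c ≥ m`, a contradiction.
-/

noncomputable section

namespace Johnson

open Finset

section LinearAlgebra

theorem finrank_map_of_disjoint_ker {K V W : Type*} [DivisionRing K] [AddCommGroup V] [Module K V]
    [AddCommGroup W] [Module K W] {f : V →ₗ[K] W} {E : Submodule K V}
    (h : Disjoint E (LinearMap.ker f)) : Module.finrank K (E.map f) = Module.finrank K E := by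
  rw [← LinearMap.range_domRestrict]
  exact LinearMap.finrank_range_of_inj (LinearMap.injective_domRestrict_iff.2 h)

theorem inner_ne_zero_of_finrank_le_one {𝕜 V : Type*} [RCLike 𝕜] [NormedAddCommGroup V]
    [InnerProductSpace 𝕜 V] {E : Submodule 𝕜 V} [FiniteDimensional 𝕜 E]
    (hE : Module.finrank 𝕜 E ≤ 1) {u v : V} (hu : u ∈ E) (hv : v ∈ E) (hu0 : u ≠ 0) (hv0 : v ≠ 0) :
    inner 𝕜 u v ≠ 0 := by
  obtain ⟨e, he⟩ := finrank_le_one_iff.1 hE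
  obtain ⟨a, rfl⟩ : ∃ a : 𝕜, a • (e : V) = u := (he ⟨u, hu⟩).imp fun _ => congrArg Subtype.val
  obtain ⟨b, rfl⟩ : ∃ b : 𝕜, b • (e : V) = v := (he ⟨v, hv⟩).imp fun _ => congrArg Subtype.val
  rw [smul_ne_zero_iff] at hu0 hv0
  simp [inner_smul_left, inner_smul_right, hu0, hv0]

end LinearAlgebra

section Isotypic

theorem disjoint_isotypicComponent {A M S S' : Type*} [Ring A] [AddCommGroup M] [Module A M]
    [AddCommGroup S] [Module A S] [IsSimpleModule A S]
    [AddCommGroup S'] [Module A S'] [IsSimpleModule A S'] (h : IsEmpty (S ≃ₗ[A] S')) :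
    Disjoint (isotypicComponent A M S) (isotypicComponent A M S') := by
  rw [disjoint_iff]
  by_contra hne
  have : IsSemisimpleModule A ↥(isotypicComponent A M S ⊓ isotypicComponent A M S') :=
    .of_injective (Submodule.inclusion inf_le_left) (Submodule.inclusion_injective _)
  have : Nontrivial ↥(isotypicComponent A M S ⊓ isotypicComponent A M S') :=
    Submodule.nontrivial_iff_ne_bot.2 hne
  obtain ⟨N, _⟩ := IsSemisimpleModule.exists_simple_submodule A
    ↥(isotypicComponent A M S ⊓ isotypicComponent A M S')
  obtain ⟨e⟩ := (IsIsotypicOfType.isotypicComponent A M S).of_injective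
    (Submodule.inclusion inf_le_left) (Submodule.inclusion_injective _) N
  obtain ⟨e'⟩ := (IsIsotypicOfType.isotypicComponent A M S').of_injective
    (Submodule.inclusion inf_le_right) (Submodule.inclusion_injective _) N
  exact h.false (e.symm.trans e')

theorem exists_smul_eq_of_mem_isotypicComponent {K A M S : Type*} [Field K] [IsAlgClosed K]
    [Ring A] [Algebra K A] [AddCommGroup M] [Module K M] [Module A M] [IsScalarTower K A M]
    [AddCommGroup S] [Module K S] [Module A S] [IsScalarTower K A S] [FiniteDimensional K S]
    [IsSimpleModule A S] {z : A} (hz : ∀ a, z * a = a * z) :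
    ∃ c : K, ∀ v ∈ isotypicComponent A M S, z • v = c • v := by
  let zS : Module.End A S :=
    { DistribSMul.toAddMonoidHom S z with map_smul' := fun a v => by simp [← mul_smul, hz] }
  obtain ⟨c, hc⟩ := (IsSimpleModule.algebraMap_end_bijective_of_isAlgClosed K).2 zS
  have hcS (s : S) : z • s = c • s := (LinearMap.congr_fun hc s).symm
  let zM : Module.End A M :=
    { DistribSMul.toAddMonoidHom M z with map_smul' := fun a v => by simp [← mul_smul, hz] }
  suffices isotypicComponent A M S ≤ LinearMap.eqLocus zM (algebraMap K _ c) from ⟨c, this⟩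
  refine sSup_le fun N ⟨e⟩ v hv => ?_
  have h : z • (⟨v, hv⟩ : N) = c • (⟨v, hv⟩ : N) := e.injective <| by
    rw [map_smul, hcS, ← algebraMap_smul A c, ← algebraMap_smul A c, map_smul]
  exact congrArg Subtype.val h

variable {𝕜 G E : Type*} [RCLike 𝕜] [Group G] [NormedAddCommGroup E] [InnerProductSpace 𝕜 E]
  [FiniteDimensional 𝕜 E] {ρ : Representation 𝕜 G E}

/-- The orthogonal complement of a submodule of a unitary representation, as a submodule over the
group algebra. -/
def orthogonalComplement (hρ : ∀ g u v, inner 𝕜 (ρ g u) (ρ g v) = inner 𝕜 u v)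
    (N : Submodule (MonoidAlgebra 𝕜 G) ρ.asModule) : Submodule (MonoidAlgebra 𝕜 G) ρ.asModule :=
  Subrepresentation.asSubmodule
    { toSubmodule := (Subrepresentation.ofSubmodule' N).toSubmoduleᗮ
      apply_mem_toSubmodule g v hv u hu := by
        rw [← ρ.self_inv_apply g u, hρ]
        exact hv _ ((Subrepresentation.ofSubmodule' N).apply_mem_toSubmodule g⁻¹ hu) }

theorem isCompl_orthogonalComplement (hρ : ∀ g u v, inner 𝕜 (ρ g u) (ρ g v) = inner 𝕜 u v)
    (N : Submodule (MonoidAlgebra 𝕜 G) ρ.asModule) : IsCompl N (orthogonalComplement hρ N) := by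
  have h := (Subrepresentation.ofSubmodule' N).toSubmodule.isCompl_orthogonal
  have hdisj := Submodule.disjoint_def.1 h.disjoint
  have hcodisj := Submodule.codisjoint_iff_exists_add_eq.1 h.codisjoint
  exact ⟨Submodule.disjoint_def.2 fun v hv hv' => hdisj v hv hv',
    Submodule.codisjoint_iff_exists_add_eq.2 fun v => hcodisj v⟩

/-- The projection onto the first component along its orthogonal complement is equivariant, so it
maps the second component into itself, hence to zero as the components are disjoint. -/
theorem inner_eq_zero_of_mem_isotypicComponent
    (hρ : ∀ g u v, inner 𝕜 (ρ g u) (ρ g v) = inner 𝕜 u v) {S S' : Type*}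
    [AddCommGroup S] [Module (MonoidAlgebra 𝕜 G) S] [IsSimpleModule (MonoidAlgebra 𝕜 G) S]
    [AddCommGroup S'] [Module (MonoidAlgebra 𝕜 G) S'] [IsSimpleModule (MonoidAlgebra 𝕜 G) S']
    (h : IsEmpty (S ≃ₗ[MonoidAlgebra 𝕜 G] S')) {u v : ρ.asModule}
    (hu : u ∈ isotypicComponent (MonoidAlgebra 𝕜 G) ρ.asModule S)
    (hv : v ∈ isotypicComponent (MonoidAlgebra 𝕜 G) ρ.asModule S') :
    inner 𝕜 (ρ.asModuleEquiv u) (ρ.asModuleEquiv v) = 0 := by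
  set N := isotypicComponent (MonoidAlgebra 𝕜 G) ρ.asModule S
  have hcompl := isCompl_orthogonalComplement hρ N
  have hPv : N.projection (orthogonalComplement hρ N) hcompl v = 0 :=
    Submodule.disjoint_def.1 (disjoint_isotypicComponent h) _
      (Submodule.projection_apply_mem hcompl v)
      (Submodule.IsFullyInvariant.isotypicComponent _ _ _ _ hv)
  exact (Submodule.projection_apply_eq_zero_iff hcompl).1 hPv u hu

end Isotypic

section LetterCount

variable {ι α : Type*} [DecidableEq α]

/-- The number of places in `s` at which the word `x` has the letter `l`. -/
def letterCount (s : Finset ι) (l : α) (x : ι → α) : ℕ :=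
  #{a ∈ s | x a = l}

theorem letterCount_insert [DecidableEq ι] {s : Finset ι} {p : ι}
    (hp : p ∉ s) (l : α) (x : ι → α) :
    letterCount (insert p s) l x = letterCount s l x + if x p = l then 1 else 0 := by
  rw [letterCount, filter_insert]
  split_ifs
  · rw [card_insert_of_notMem (by simp [hp]), letterCount]
  · rfl

theorem letterCount_eq_of_eqOn_compl [Fintype ι] {s : Finset ι} {l : α} {x y : ι → α}
    (hxy : ∀ a ∉ s, x a = y a) (h : letterCount univ l x = letterCount univ l y) :
    letterCount s l x = letterCount s l y := by
  classical
  have hsplit (z : ι → α) : letterCount univ l z = letterCount s l z + letterCount sᶜ l z := by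
    simp only [letterCount, card_filter]
    exact (sum_add_sum_compl s _).symm
  have hcompl : letterCount sᶜ l x = letterCount sᶜ l y :=
    congrArg card (filter_congr fun a ha => by rw [hxy a (mem_compl.1 ha)])
  rw [hsplit, hsplit, hcompl] at h
  exact Nat.add_right_cancel h

end LetterCount

section Words

variable {ι α R : Type*} [DecidableEq ι] [CommRing R]

/-- The action of the permutation `σ` of the places on functions on words. -/
def permutePlaces (σ : Equiv.Perm ι) : Module.End R ((ι → α) → R) :=
  LinearMap.funLeft R R fun x => x ∘ σ

/-- The sum of the transpositions `(a b)` over all ordered pairs of places in `s`, with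
`(a a) = 1`. It is the image of a central element of the group algebra of the symmetric group on
`s`. -/
def swapSum (s : Finset ι) : Module.End R ((ι → α) → R) :=
  ∑ a ∈ s, ∑ b ∈ s, permutePlaces (Equiv.swap a b)

/-- The Jucys–Murphy operator: the sum of the transpositions of the place `p` with the places in
`s`. -/
def jucysMurphy (s : Finset ι) (p : ι) : Module.End R ((ι → α) → R) :=
  ∑ a ∈ s, permutePlaces (Equiv.swap a p)

theorem swapSum_insert {s : Finset ι} {p : ι} (hp : p ∉ s) :
    (swapSum (insert p s) : Module.End R ((ι → α) → R)) =
      swapSum s + 2 * jucysMurphy s p + 1 := by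
  have h : (permutePlaces (Equiv.swap p p) : Module.End R ((ι → α) → R)) = 1 := by
    rw [Equiv.swap_self]; rfl
  simp only [swapSum, jucysMurphy, sum_insert hp, sum_add_distrib, Equiv.swap_comm p, h]
  noncomm_ring

variable [DecidableEq α]

/-- The matrix unit `E_{l l'}` acting on the tensor factor at the place `a`, functions on words
being tensors in `(R^α)^{⊗ ι}`. -/
def matrixUnit (a : ι) (l l' : α) : Module.End R ((ι → α) → R) where
  toFun f x := if x a = l then f (Function.update x a l') else 0
  map_add' f g := funext fun x => by simp only [Pi.add_apply]; split_ifs <;> simp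
  map_smul' c f := funext fun x => by simp

theorem matrixUnit_apply (a : ι) (l l' : α) (f : (ι → α) → R) (x : ι → α) :
    matrixUnit a l l' f x = if x a = l then f (Function.update x a l') else 0 :=
  rfl

theorem matrixUnit_self_apply (a : ι) (l : α) (f : (ι → α) → R) (x : ι → α) :
    matrixUnit a l l f x = if x a = l then f x else 0 := by
  rw [matrixUnit_apply]
  split_ifs with h
  · rw [← h, Function.update_eq_self]
  · rfl

theorem matrixUnit_mul_matrixUnit (a : ι) (l l' m : α) :
    (matrixUnit a l l' * matrixUnit a l' m : Module.End R ((ι → α) → R)) = matrixUnit a l m := by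
  ext f x
  simp [matrixUnit_apply]

theorem commute_matrixUnit_of_ne {a b : ι} (hab : a ≠ b) (l l' m m' : α) :
    Commute (matrixUnit a l l' : Module.End R ((ι → α) → R)) (matrixUnit b m m') := by
  ext f x
  simp only [Module.End.mul_apply, matrixUnit_apply, Function.update_of_ne hab,
    Function.update_of_ne hab.symm, Function.update_comm hab, ← ite_and, and_comm]

theorem commute_matrixUnit_permutePlaces {a : ι} {σ : Equiv.Perm ι} (hσ : σ a = a) (l l' : α) :
    Commute (matrixUnit a l l' : Module.End R ((ι → α) → R)) (permutePlaces σ) := by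
  ext f x
  have h : Function.update x a l' ∘ σ = Function.update (x ∘ σ) a l' := by
    rw [Function.update_comp_equiv, σ.symm_apply_eq.2 hσ.symm]
  simp [matrixUnit_apply, permutePlaces, LinearMap.funLeft_apply, hσ, h]

theorem commute_matrixUnit_jucysMurphy {s : Finset ι} {a p : ι} (ha : a ∉ s) (hap : a ≠ p)
    (l l' : α) :
    Commute (matrixUnit a l l' : Module.End R ((ι → α) → R)) (jucysMurphy s p) :=
  Commute.sum_right _ _ _ fun _ hb => commute_matrixUnit_permutePlaces
    (Equiv.swap_apply_of_ne_of_ne (ne_of_mem_of_not_mem hb ha).symm hap) l l'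

/-- The polarization operator: the action of the matrix unit `E_{l l'}` of the Lie algebra `gl(α)`
on the tensor factors at the places in `s`. -/
def polarization (s : Finset ι) (l l' : α) : Module.End R ((ι → α) → R) :=
  ∑ a ∈ s, matrixUnit a l l'

theorem polarization_apply (s : Finset ι) (l l' : α) (f : (ι → α) → R) (x : ι → α) :
    polarization s l l' f x = ∑ a ∈ s, matrixUnit a l l' f x := by
  simp [polarization]

theorem polarization_self_apply (s : Finset ι) (l : α) (f : (ι → α) → R) (x : ι → α) :
    polarization s l l f x = letterCount s l x * f x := by
  simp [polarization_apply, matrixUnit_self_apply, letterCount, ← sum_filter]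

theorem lie_polarization (s : Finset ι) (l l' : α) :
    ⁅(polarization s l l' : Module.End R ((ι → α) → R)),
      (polarization s l' l : Module.End R ((ι → α) → R))⁆ =
      polarization s l l - polarization s l' l' := by
  simp only [polarization, Ring.lie_def, sum_mul_sum]
  rw [sum_comm (f := fun a b => matrixUnit a l' l * matrixUnit b l l')]
  simp only [← sum_sub_distrib]
  refine sum_congr rfl fun a ha => ?_
  have hcomm (b : ι) (hba : b ≠ a) :
      (matrixUnit a l l' * matrixUnit b l' l : Module.End R ((ι → α) → R)) -
        matrixUnit b l' l * matrixUnit a l l' = 0 :=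
    sub_eq_zero.2 (commute_matrixUnit_of_ne hba.symm l l' l' l)
  rw [sum_eq_single_of_mem a ha fun b _ => hcomm b, matrixUnit_mul_matrixUnit,
    matrixUnit_mul_matrixUnit]

theorem matrixUnit_jucysMurphy_apply {s : Finset ι} {p : ι} (hp : p ∉ s) {l : α}
    {f : (ι → α) → R} (hf : ∀ x, f x ≠ 0 → x p = l) (l' : α) :
    matrixUnit p l l' (jucysMurphy s p f) = polarization s l l' f := by
  ext x
  rw [polarization_apply, jucysMurphy, LinearMap.sum_apply, map_sum, Finset.sum_apply]
  refine sum_congr rfl fun a ha => ?_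
  have hap : a ≠ p := ne_of_mem_of_not_mem ha hp
  have hzero (z : ι → α) (hz : z p ≠ l) : f z = 0 := by_contra fun h => hz (hf z h)
  simp only [matrixUnit_apply, permutePlaces, LinearMap.funLeft_apply]
  by_cases hxp : x p = l
  · by_cases hxa : x a = l
    · rw [if_pos hxp, if_pos hxa, Function.update_comp_equiv, Equiv.symm_swap,
        Equiv.swap_apply_right, Equiv.comp_swap_eq_update, hxa, ← hxp, Function.update_eq_self,
        hxp, ← hxa, Function.update_eq_self]
    · rw [if_pos hxp, if_neg hxa, hzero]
      simpa [hap] using hxa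
  · rw [if_neg hxp, hzero _ (by rwa [Function.update_of_ne hap.symm]), ite_self]

theorem star_polarization [StarRing R] (s : Finset ι) (l l' : α) (f : (ι → α) → R) :
    star (polarization s l l' f) = polarization s l l' (star f) := by
  ext x
  simp only [Pi.star_apply, polarization_apply, star_sum, matrixUnit_apply]
  exact sum_congr rfl fun a _ => by split_ifs <;> simp

theorem matrixUnit_dotProduct [Fintype ι] [Fintype α] (a : ι) (l l' : α) (f g : (ι → α) → R) :
    matrixUnit a l l' f ⬝ᵥ g = f ⬝ᵥ matrixUnit a l' l g := by
  simp only [dotProduct, matrixUnit_apply, ite_mul, mul_ite, zero_mul, mul_zero, ← sum_filter]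
  refine sum_bij' (fun x _ => Function.update x a l') (fun x _ => Function.update x a l)
    ?_ ?_ ?_ ?_ ?_ <;>
  · intro x hx
    obtain rfl := (mem_filter.1 hx).2
    simp

theorem polarization_dotProduct [Fintype ι] [Fintype α] (s : Finset ι) (l l' : α)
    (f g : (ι → α) → R) :
    polarization s l l' f ⬝ᵥ g = f ⬝ᵥ polarization s l' l g := by
  simp only [polarization, LinearMap.sum_apply, sum_dotProduct, dotProduct_sum,
    matrixUnit_dotProduct]

theorem sum_norm_polarization_sq [Fintype ι] [Fintype α] {𝕜 : Type*} [RCLike 𝕜] {s : Finset ι}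
    {l l' : α} {f : (ι → α) → 𝕜} (hf : polarization s l l' f = 0) :
    ∑ x, ‖polarization s l' l f x‖ ^ 2 =
      ∑ x, ((letterCount s l x : ℝ) - letterCount s l' x) * ‖f x‖ ^ 2 := by
  have hlie : polarization s l l' (polarization s l' l f) =
      polarization s l l f - polarization s l' l' f := by
    have h := LinearMap.congr_fun (lie_polarization s l l') f
    rwa [Ring.lie_def, LinearMap.sub_apply, Module.End.mul_apply, Module.End.mul_apply, hf,
      map_zero, sub_zero] at h
  have hdot : star (polarization s l' l f) ⬝ᵥ polarization s l' l f =
      star f ⬝ᵥ (polarization s l l f - polarization s l' l' f) := by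
    rw [star_polarization, polarization_dotProduct, hlie]
  rw [← RCLike.ofReal_inj (K := 𝕜)]
  simpa [dotProduct, polarization_self_apply, RCLike.conj_mul, ← sub_mul, mul_left_comm] using hdot

theorem eq_zero_of_polarization_eq_zero [Finite ι] [Finite α] {𝕜 : Type*} [RCLike 𝕜]
    {s : Finset ι} {l l' : α} {f : (ι → α) → 𝕜} (hf : polarization s l l' f = 0)
    (hlt : ∀ x, f x ≠ 0 → letterCount s l x < letterCount s l' x) : f = 0 := by
  cases nonempty_fintype ι
  cases nonempty_fintype α
  by_contra hne
  obtain ⟨y, hy⟩ := Function.ne_iff.1 hne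
  have hneg (x) (hx : f x ≠ 0) :
      ((letterCount s l x : ℝ) - letterCount s l' x) * ‖f x‖ ^ 2 < 0 :=
    mul_neg_of_neg_of_pos (sub_neg.2 (Nat.cast_lt.2 (hlt x hx))) (by positivity)
  have hsum : ∑ x, ((letterCount s l x : ℝ) - letterCount s l' x) * ‖f x‖ ^ 2 < 0 := by
    refine sum_neg' (fun x _ => ?_) ⟨y, mem_univ y, hneg y hy⟩
    by_cases hx : f x = 0
    · simp [hx]
    · exact (hneg x hx).le
  rw [← sum_norm_polarization_sq hf] at hsum
  exact hsum.not_ge (by positivity)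

theorem jucysMurphy_eigenvalue_eq_letterCount [IsDomain R] {s : Finset ι} {p : ι} (hp : p ∉ s)
    {l : α} {c : R} {f : (ι → α) → R} (hfp : ∀ x, f x ≠ 0 → x p = l)
    (hf : jucysMurphy s p f = c • f) {x : ι → α} (hx : f x ≠ 0) : c = letterCount s l x := by
  have h := congrFun (matrixUnit_jucysMurphy_apply hp hfp l) x
  rw [hf, map_smul, Pi.smul_apply, matrixUnit_self_apply, if_pos (hfp x hx),
    polarization_self_apply, smul_eq_mul] at h
  exact mul_right_cancel₀ hx h

theorem polarization_eq_zero_of_jucysMurphy_eq_smul {s : Finset ι} {p : ι} (hp : p ∉ s)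
    {l l' : α} (hl : l ≠ l') {c : R} {f : (ι → α) → R} (hfp : ∀ x, f x ≠ 0 → x p = l)
    (hf : jucysMurphy s p f = c • f) : polarization s l l' f = 0 := by
  have hzero : matrixUnit p l l' f = 0 := by
    ext x
    have h : f (Function.update x p l') = 0 :=
      by_contra fun h => hl <| by simpa using (hfp _ h).symm
    rw [matrixUnit_apply, h, ite_self, Pi.zero_apply]
  rw [← matrixUnit_jucysMurphy_apply hp hfp, hf, map_smul, hzero, smul_zero]

/-- Let the words in the supports have `m` letters `l` in `insert p s`. The eigenvalue `c` equals
`m - 1`, the number of letters `l` in `s` for `f`; it is also the number of letters `l'` in `s` for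
`g`, which has `m` letters `l` there. But a nonzero function killed by `polarization s l' l` cannot
have more letters `l` than letters `l'` in `s` throughout its support. -/
theorem eq_zero_of_jucysMurphy_eq_smul [Finite ι] [Finite α] {𝕜 : Type*} [RCLike 𝕜] {s : Finset ι}
    {p : ι} (hp : p ∉ s) {l l' : α} (hl : l ≠ l') {c : 𝕜} {f g : (ι → α) → 𝕜}
    (hfp : ∀ x, f x ≠ 0 → x p = l) (hgp : ∀ x, g x ≠ 0 → x p = l')
    (hcount : ∀ x y, f x ≠ 0 → g y ≠ 0 →
      letterCount (insert p s) l x = letterCount (insert p s) l y)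
    (hf : jucysMurphy s p f = c • f) (hg : jucysMurphy s p g = c • g) (hf0 : f ≠ 0) : g = 0 := by
  obtain ⟨x, hx⟩ := Function.ne_iff.1 hf0
  refine eq_zero_of_polarization_eq_zero
    (polarization_eq_zero_of_jucysMurphy_eq_smul hp hl.symm hgp hg) fun y hy => ?_
  have hxy : letterCount s l x = letterCount s l' y := Nat.cast_injective (R := 𝕜) <|
    (jucysMurphy_eigenvalue_eq_letterCount hp hfp hf hx).symm.trans
      (jucysMurphy_eigenvalue_eq_letterCount hp hgp hg hy)
  have h := hcount x y hx hy
  rw [letterCount_insert hp, letterCount_insert hp, if_pos (hfp x hx),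
    if_neg (by rw [hgp y hy]; exact hl.symm)] at h
  omega

end Words

section GelfandTsetlin

/-- The set of the first `i` places of a word of length `n`. -/
def firstPlaces (n i : ℕ) : Finset (Fin n) := {a | (a : ℕ) < i}

@[simp]
theorem mem_firstPlaces {n i : ℕ} {a : Fin n} : a ∈ firstPlaces n i ↔ (a : ℕ) < i := by
  simp [firstPlaces]

theorem firstPlaces_succ {n : ℕ} (p : Fin n) :
    firstPlaces n (p + 1) = insert p (firstPlaces n p) := by
  ext a
  rw [mem_insert, mem_firstPlaces, mem_firstPlaces, Nat.lt_succ_iff_lt_or_eq, Fin.ext_iff, or_comm]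

variable {n i : ℕ}

/-- The properties of a Gelfand–Tsetlin subspace `F^w_T` with `w = c_{i+1} ⋯ c_n` that make it at
most one-dimensional: the words in the supports of its elements have the same number of letters `1`
and the same letters at the places `i + 1, …, n`, and the Jucys–Murphy elements of `S_i` act on it
by scalars. -/
structure IsGelfandTsetlin (i : ℕ) (E : Submodule ℂ ((Fin n → Letter) → ℂ)) : Prop where
  letterCount_eq : ∀ f ∈ E, ∀ g ∈ E, ∀ x y, f x ≠ 0 → g y ≠ 0 →
    letterCount univ Letter.one x = letterCount univ Letter.one y
  apply_eq : ∀ f ∈ E, ∀ g ∈ E, ∀ x y, f x ≠ 0 → g y ≠ 0 → ∀ a : Fin n, i ≤ (a : ℕ) → x a = y a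
  exists_eigenvalue : ∀ p : Fin n, (p : ℕ) < i →
    ∃ c : ℂ, ∀ f ∈ E, jucysMurphy (firstPlaces n p) p f = c • f

namespace IsGelfandTsetlin

variable {E : Submodule ℂ ((Fin n → Letter) → ℂ)}

theorem map_matrixUnit {p : Fin n} (hE : IsGelfandTsetlin (p + 1) E) (l : Letter) :
    IsGelfandTsetlin p (E.map (matrixUnit p l l)) := by
  have hsupp {f : (Fin n → Letter) → ℂ} {x} (hx : matrixUnit p l l f x ≠ 0) :
      x p = l ∧ f x ≠ 0 := by
    simpa [matrixUnit_self_apply] using hx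
  constructor
  · rintro _ ⟨f, hf, rfl⟩ _ ⟨g, hg, rfl⟩ x y hx hy
    exact hE.letterCount_eq f hf g hg x y (hsupp hx).2 (hsupp hy).2
  · rintro _ ⟨f, hf, rfl⟩ _ ⟨g, hg, rfl⟩ x y hx hy a ha
    obtain hpa | hpa := ha.eq_or_lt
    · rw [← Fin.ext hpa, (hsupp hx).1, (hsupp hy).1]
    · exact hE.apply_eq f hf g hg x y (hsupp hx).2 (hsupp hy).2 a hpa
  · intro q hq
    obtain ⟨c, hc⟩ := hE.exists_eigenvalue q (Nat.lt_succ_of_lt hq)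
    refine ⟨c, ?_⟩
    rintro _ ⟨f, hf, rfl⟩
    have hcomm : Commute (matrixUnit p l l : Module.End ℂ ((Fin n → Letter) → ℂ))
        (jucysMurphy (firstPlaces n q) q) :=
      commute_matrixUnit_jucysMurphy (by simpa using hq.le) (Fin.ne_of_gt hq) l l
    rw [← Module.End.mul_apply, ← hcomm.eq, Module.End.mul_apply, hc f hf, map_smul]

theorem disjoint_ker_matrixUnit {p : Fin n} (hE : IsGelfandTsetlin (p + 1) E) :
    Disjoint E (LinearMap.ker (matrixUnit p Letter.one Letter.one)) ∨
      Disjoint E (LinearMap.ker (matrixUnit p Letter.two Letter.two)) := by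
  obtain ⟨c, hc⟩ := hE.exists_eigenvalue p p.val.lt_succ_self
  have hsupp {l : Letter} {f : (Fin n → Letter) → ℂ} (hf : matrixUnit p l l f = 0) {x}
      (hx : f x ≠ 0) : x p ≠ l := fun hxp =>
    hx <| by simpa [matrixUnit_self_apply, hxp] using congrFun hf x
  simp only [LinearMap.disjoint_ker]
  by_contra! ⟨⟨g, hg, hgone, hg0⟩, f, hf, hftwo, hf0⟩
  have hfp (x) (hx : f x ≠ 0) : x p = Letter.one := by
    cases h : x p with
    | one => rfl
    | two => exact absurd h (hsupp hftwo hx)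
  have hgp (x) (hx : g x ≠ 0) : x p = Letter.two := by
    cases h : x p with
    | one => exact absurd h (hsupp hgone hx)
    | two => rfl
  refine hg0 (eq_zero_of_jucysMurphy_eq_smul (by simp) (by decide) hfp hgp (fun x y hx hy => ?_)
    (hc f hf) (hc g hg) hf0)
  rw [← firstPlaces_succ]
  refine letterCount_eq_of_eqOn_compl (fun a ha => ?_) (hE.letterCount_eq f hf g hg x y hx hy)
  exact hE.apply_eq f hf g hg x y hx hy a (by simpa using ha)

theorem finrank_le_one_of_zero (hE : IsGelfandTsetlin 0 E) : Module.finrank ℂ E ≤ 1 := by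
  obtain rfl | hne := eq_or_ne E ⊥
  · simp
  obtain ⟨f, hf, hf0⟩ := E.exists_mem_ne_zero_of_ne_bot hne
  obtain ⟨x, hx⟩ := Function.ne_iff.1 hf0
  have hle : E ≤ Submodule.span ℂ {Pi.single x 1} := by
    refine fun g hg => Submodule.mem_span_singleton.2 ⟨g x, funext fun y => ?_⟩
    obtain rfl | hyx := eq_or_ne y x
    · simp
    · have hy : g y = 0 := by_contra fun hy =>
        hyx <| funext fun a => hE.apply_eq g hg f hf y x hy hx a (Nat.zero_le _)
      simp [hyx, hy]
  exact (Submodule.finrank_mono hle).trans (finrank_span_singleton (by simp)).le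

theorem finrank_le_one (hE : IsGelfandTsetlin i E) (hi : i ≤ n) : Module.finrank ℂ E ≤ 1 := by
  induction i generalizing E with
  | zero => exact hE.finrank_le_one_of_zero
  | succ i ih =>
    have hmap (l : Letter) :
        Module.finrank ℂ (E.map (matrixUnit ⟨i, hi⟩ l l)) ≤ 1 :=
      ih (hE.map_matrixUnit (p := ⟨i, hi⟩) l) (Nat.le_of_succ_le hi)
    obtain h | h := hE.disjoint_ker_matrixUnit (p := ⟨i, hi⟩)
    · exact (finrank_map_of_disjoint_ker h).symm.trans_le (hmap _)
    · exact (finrank_map_of_disjoint_ker h).symm.trans_le (hmap _)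

end IsGelfandTsetlin

end GelfandTsetlin

section GelfandTsetlinSpace

variable {n k i j : ℕ}

/-- The extension by zero of a function on `X` to all words. -/
def extendByZero (n k : ℕ) : F n k →ₗ[ℂ] ((Fin n → Letter) → ℂ) :=
  Function.ExtendByZero.linearMap ℂ Subtype.val ∘ₗ (WithLp.linearEquiv 2 ℂ (X n k → ℂ)).toLinearMap

theorem extendByZero_apply_val (f : F n k) (x : X n k) : extendByZero n k f x.1 = f x :=
  Subtype.val_injective.extend_apply _ _ x

theorem extendByZero_apply_eq_zero (f : F n k) {x : Fin n → Letter}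
    (hx : #{a | x a = Letter.one} ≠ k) : extendByZero n k f x = 0 :=
  Function.extend_apply' _ _ x fun ⟨y, hy⟩ => hx (hy ▸ y.2)

theorem exists_of_extendByZero_apply_ne_zero {f : F n k} {x : Fin n → Letter}
    (hx : extendByZero n k f x ≠ 0) : ∃ y : X n k, y.1 = x ∧ f y ≠ 0 := by
  have h : #{a | x a = Letter.one} = k := by_contra fun h => hx (extendByZero_apply_eq_zero f h)
  exact ⟨⟨x, h⟩, rfl, by rwa [← extendByZero_apply_val]⟩

theorem extendByZero_injective : Function.Injective (extendByZero n k) := fun f g h =>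
  PiLp.ext fun x => by rw [← extendByZero_apply_val, h, extendByZero_apply_val]

theorem extendByZero_rep (σ : Equiv.Perm (Fin n)) (f : F n k) :
    extendByZero n k (rep n k σ f) = permutePlaces σ (extendByZero n k f) := by
  ext x
  by_cases hx : #{a | x a = Letter.one} = k
  · exact (extendByZero_apply_val (rep n k σ f) ⟨x, hx⟩).trans
      (extendByZero_apply_val f (permInv σ ⟨x, hx⟩)).symm
  · have hcard : #{a | x (σ a) = Letter.one} = #{a | x a = Letter.one} := card_equiv σ (by simp)
    exact (extendByZero_apply_eq_zero _ hx).trans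
      (extendByZero_apply_eq_zero f (hcard.trans_ne hx)).symm

theorem permInv_injective (σ : Equiv.Perm (Fin n)) :
    Function.Injective (permInv (k := k) σ) := fun _ _ h =>
  Subtype.ext (σ.surjective.injective_comp_right (congrArg Subtype.val h))

theorem inner_rep (σ : Equiv.Perm (Fin n)) (f g : F n k) :
    inner ℂ (rep n k σ f) (rep n k σ g) = inner ℂ f g := by
  rw [PiLp.inner_apply, PiLp.inner_apply]
  exact (Finite.injective_iff_bijective.1 (permInv_injective σ)).sum_comp
    fun x => inner ℂ (f x) (g x)

theorem apply_mem_firstPlaces_iff (σ : symSub n j) (a : Fin n) :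
    σ.1 a ∈ firstPlaces n j ↔ a ∈ firstPlaces n j := by
  have hfix (p : Fin n) (hp : p ∉ firstPlaces n j) : σ.1 p = p :=
    (mem_fixingSubgroup_iff _).1 σ.2 p (by simpa using hp)
  exact not_iff_not.1 ⟨fun h => by rwa [σ.1.injective (hfix _ h)] at h,
    fun h => by rwa [hfix a h]⟩

theorem swap_mem_symSub {a b : Fin n} (ha : a ∈ firstPlaces n j) (hb : b ∈ firstPlaces n j) :
    Equiv.swap a b ∈ symSub n j := by
  refine (mem_fixingSubgroup_iff _).2 fun p (hp : j ≤ p) => ?_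
  have hp' : p ∉ firstPlaces n j := by simpa using hp
  exact Equiv.swap_apply_of_ne_of_ne (ne_of_mem_of_not_mem ha hp').symm
    (ne_of_mem_of_not_mem hb hp').symm

/-- The element of the group algebra of `S_j` that acts as `swapSum (firstPlaces n j)`. -/
def swapElement (n j : ℕ) : MonoidAlgebra ℂ (symSub n j) :=
  ∑ a : firstPlaces n j, ∑ b : firstPlaces n j,
    MonoidAlgebra.of ℂ _ ⟨Equiv.swap a.1 b.1, swap_mem_symSub a.2 b.2⟩

theorem swapElement_mul_comm (r : MonoidAlgebra ℂ (symSub n j)) :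
    swapElement n j * r = r * swapElement n j := by
  induction r using MonoidAlgebra.induction_on with
  | of g =>
    simp only [swapElement, sum_mul, mul_sum, ← map_mul]
    rw [← Equiv.sum_comp (g.1.subtypePerm (apply_mem_firstPlaces_iff g))]
    refine sum_congr rfl fun a _ => ?_
    rw [← Equiv.sum_comp (g.1.subtypePerm (apply_mem_firstPlaces_iff g))]
    refine sum_congr rfl fun b _ => congrArg _ (Subtype.ext ?_)
    exact (Equiv.mul_swap_eq_swap_mul g.1 a.1 b.1).symm
  | add r s hr hs => rw [mul_add, add_mul, hr, hs]
  | smul c r hr => rw [mul_smul_comm, smul_mul_assoc, hr]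

theorem extendByZero_swapElement (f : F n k) :
    extendByZero n k ((repSub n k j).asAlgebraHom (swapElement n j) f) =
      swapSum (firstPlaces n j) (extendByZero n k f) := by
  simp only [swapElement, swapSum, map_sum, LinearMap.sum_apply, ← sum_coe_sort (firstPlaces n j),
    Representation.asAlgebraHom_of]
  exact sum_congr rfl fun a _ => sum_congr rfl fun b _ => extendByZero_rep _ f

theorem exists_swapSum_eq_smul_of_mem_isotypic (k : ℕ) (lam : Irr (symSub n j)) :
    ∃ c : ℂ, ∀ f ∈ isotypic n k j lam,
      swapSum (firstPlaces n j) (extendByZero n k f) = c • extendByZero n k f := by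
  induction lam using Quotient.inductionOn with | _ V
  have := V.2
  have : FiniteDimensional ℂ (MonoidAlgebra ℂ (symSub n j)) :=
    .of_basis (MonoidAlgebra.basis (symSub n j) ℂ)
  have : FiniteDimensional ℂ V.1 :=
    inferInstanceAs (FiniteDimensional ℂ (V.1.restrictScalars ℂ))
  obtain ⟨c, hc⟩ := exists_smul_eq_of_mem_isotypicComponent (K := ℂ)
    (M := (repSub n k j).asModule) (S := V.1) (swapElement_mul_comm (n := n) (j := j))
  refine ⟨c, ?_⟩
  rintro _ ⟨v, hv, rfl⟩
  have h := congrArg (repSub n k j).asModuleEquiv (hc v hv)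
  rw [Representation.asModuleEquiv_map_smul, map_smul] at h
  rw [← map_smul, ← extendByZero_swapElement]
  exact congrArg _ h

theorem exists_swapSum_eq_smul_of_mem_gtSpace (w : Word n k i) (T : Chain n i) (hj : j ≤ i) :
    ∃ c : ℂ, ∀ f ∈ gtSpace w T,
      swapSum (firstPlaces n j) (extendByZero n k f) = c • extendByZero n k f := by
  cases j with
  | zero => exact ⟨0, fun f _ => by simp [swapSum, firstPlaces]⟩
  | succ j =>
    obtain ⟨c, hc⟩ := exists_swapSum_eq_smul_of_mem_isotypic k (T.irr ⟨j, hj⟩)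
    exact ⟨c, fun f hf => hc f ((Submodule.mem_iInf _).1 hf.1 ⟨j, hj⟩)⟩

theorem exists_jucysMurphy_eq_smul_of_mem_gtSpace (w : Word n k i) (T : Chain n i) {p : Fin n}
    (hp : (p : ℕ) < i) :
    ∃ c : ℂ, ∀ f ∈ gtSpace w T,
      jucysMurphy (firstPlaces n p) p (extendByZero n k f) = c • extendByZero n k f := by
  obtain ⟨c, hc⟩ := exists_swapSum_eq_smul_of_mem_gtSpace w T hp.le
  obtain ⟨d, hd⟩ := exists_swapSum_eq_smul_of_mem_gtSpace w T (Nat.succ_le_of_lt hp)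
  refine ⟨(d - c - 1) / 2, fun f hf => ?_⟩
  have h := hd f hf
  rw [firstPlaces_succ, swapSum_insert (by simp), LinearMap.add_apply, LinearMap.add_apply,
    hc f hf, two_mul, LinearMap.add_apply, Module.End.one_apply] at h
  ext x
  have hx := congrFun h x
  simp only [Pi.add_apply, Pi.smul_apply, smul_eq_mul] at hx ⊢
  linear_combination hx / 2

theorem apply_eq_of_mem_wordSpace {w : Word n k i} {f : F n k} (hf : f ∈ wordSpace w) {x : X n k}
    (hx : f x ≠ 0) (a : {a : Fin n // i ≤ (a : ℕ)}) : x.1 a.1 = w.1 a := by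
  contrapose! hx
  induction hf using Submodule.span_induction with
  | mem f hf =>
    obtain ⟨y, hy, rfl⟩ := hf
    have hxy : x ≠ y := fun h => hx (h ▸ hy a)
    simp [hxy]
  | zero => rfl
  | add f g _ _ hf hg => simp [hf, hg]
  | smul c f _ hf => simp [hf]

theorem isGelfandTsetlin_map_gtSpace (w : Word n k i) (T : Chain n i) :
    IsGelfandTsetlin i ((gtSpace w T).map (extendByZero n k)) := by
  constructor
  · rintro _ ⟨f, -, rfl⟩ _ ⟨g, -, rfl⟩ x y hx hy
    obtain ⟨x, rfl, -⟩ := exists_of_extendByZero_apply_ne_zero hx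
    obtain ⟨y, rfl, -⟩ := exists_of_extendByZero_apply_ne_zero hy
    exact x.2.trans y.2.symm
  · rintro _ ⟨f, hf, rfl⟩ _ ⟨g, hg, rfl⟩ x y hx hy a ha
    obtain ⟨x, rfl, hfx⟩ := exists_of_extendByZero_apply_ne_zero hx
    obtain ⟨y, rfl, hgy⟩ := exists_of_extendByZero_apply_ne_zero hy
    exact (apply_eq_of_mem_wordSpace hf.2 hfx ⟨a, ha⟩).trans
      (apply_eq_of_mem_wordSpace hg.2 hgy ⟨a, ha⟩).symm
  · intro p hp
    obtain ⟨c, hc⟩ := exists_jucysMurphy_eq_smul_of_mem_gtSpace w T hp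
    refine ⟨c, ?_⟩
    rintro _ ⟨f, hf, rfl⟩
    exact hc f hf

theorem finrank_gtSpace_le_one (hi : i ≤ n) (w : Word n k i) (T : Chain n i) :
    Module.finrank ℂ (gtSpace w T) ≤ 1 := by
  rw [← finrank_map_of_disjoint_ker (f := extendByZero n k)
    (by simp [LinearMap.ker_eq_bot.2 extendByZero_injective])]
  exact (isGelfandTsetlin_map_gtSpace w T).finrank_le_one hi

theorem eq_of_mem_isotypic_of_inner_ne_zero {mu lam : Irr (symSub n i)} {f g : F n k}
    (hf : f ∈ isotypic n k i mu) (hg : g ∈ isotypic n k i lam) (h : inner ℂ f g ≠ 0) :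
    mu = lam := by
  induction mu using Quotient.inductionOn with | _ V
  induction lam using Quotient.inductionOn with | _ W
  obtain ⟨u, hu, rfl⟩ := hf
  obtain ⟨v, hv, rfl⟩ := hg
  have := V.2
  have := W.2
  by_contra hne
  exact h (inner_eq_zero_of_mem_isotypicComponent (ρ := repSub n k i) (fun σ => inner_rep σ.1)
    ⟨fun e => hne (Quotient.sound ⟨e⟩)⟩ hu hv)

theorem chain_eq_init_of_inner_ne_zero {w : Word n k (i + 1)} {w' : Word n k i}
    {T : Chain n (i + 1)} {T' : Chain n i} {b b' : F n k} (hb : b ∈ gtSpace w T)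
    (hb' : b' ∈ gtSpace w' T') (h : inner ℂ b' b ≠ 0) : T' = T.init :=
  Chain.ext <| funext fun j => eq_of_mem_isotypic_of_inner_ne_zero
    ((Submodule.mem_iInf _).1 hb'.1 j) ((Submodule.mem_iInf _).1 hb.1 j.castSucc) h

theorem word_apply_eq_of_inner_ne_zero {w : Word n k i} {w' : Word n k j} {b b' : F n k}
    (hb : b ∈ wordSpace w) (hb' : b' ∈ wordSpace w') (h : inner ℂ b' b ≠ 0) {a : Fin n}
    (hi : i ≤ (a : ℕ)) (hj : j ≤ (a : ℕ)) : w'.1 ⟨a, hj⟩ = w.1 ⟨a, hi⟩ := by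
  rw [PiLp.inner_apply] at h
  obtain ⟨x, -, hx⟩ := exists_ne_zero_of_sum_ne_zero h
  have hbx : b x ≠ 0 := fun h => hx (by simp [h])
  have hbx' : b' x ≠ 0 := fun h => hx (by simp [h])
  rw [← apply_eq_of_mem_wordSpace hb hbx, ← apply_eq_of_mem_wordSpace hb' hbx']

theorem word_eq_of_inner_ne_zero {w : Word n k (i + 1)} {w₁ w₂ : Word n k i} {b b₁ b₂ : F n k}
    (hb : b ∈ wordSpace w) (hb₁ : b₁ ∈ wordSpace w₁) (hb₂ : b₂ ∈ wordSpace w₂)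
    (h₁ : inner ℂ b₁ b ≠ 0) (h₂ : inner ℂ b₂ b ≠ 0) (hi : i < n)
    (hw : w₁.1 ⟨⟨i, hi⟩, le_rfl⟩ = w₂.1 ⟨⟨i, hi⟩, le_rfl⟩) : w₁ = w₂ := by
  refine Subtype.ext (funext fun ⟨a, ha⟩ => ?_)
  obtain hia | hia := ha.eq_or_lt
  · obtain rfl : (⟨i, hi⟩ : Fin n) = a := Fin.ext hia
    exact hw
  · exact (word_apply_eq_of_inner_ne_zero hb hb₁ h₁ hia ha).trans
      (word_apply_eq_of_inner_ne_zero hb hb₂ h₂ hia ha).symm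

theorem IsIntermediateBasis.eq_of_inner_ne_zero {B : Set (F n k)}
    (hB : IsIntermediateBasis n k i B) (hi : i < n) {w : Word n k (i + 1)} {w₁ w₂ : Word n k i}
    {T : Chain n (i + 1)} {T₁ T₂ : Chain n i} {b b₁ b₂ : F n k} (hb : b ∈ gtSpace w T)
    (hb₁ : b₁ ∈ gtSpace w₁ T₁) (hb₂ : b₂ ∈ gtSpace w₂ T₂) (hB₁ : b₁ ∈ B) (hB₂ : b₂ ∈ B)
    (h₁ : inner ℂ b₁ b ≠ 0) (h₂ : inner ℂ b₂ b ≠ 0)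
    (hw : w₁.1 ⟨⟨i, hi⟩, le_rfl⟩ = w₂.1 ⟨⟨i, hi⟩, le_rfl⟩) : b₁ = b₂ := by
  obtain rfl := word_eq_of_inner_ne_zero hb.2 hb₁.2 hb₂.2 h₁ h₂ hi hw
  obtain rfl := chain_eq_init_of_inner_ne_zero hb hb₁ h₁
  obtain rfl := chain_eq_init_of_inner_ne_zero hb hb₂ h₂
  by_contra hne
  refine inner_ne_zero_of_finrank_le_one (finrank_gtSpace_le_one hi.le _ _) hb₁ hb₂
    (fun h => h₁ (by simp [h])) (fun h => h₂ (by simp [h])) ?_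
  exact hB.orthonormal.2 (i := ⟨b₁, hB₁⟩) (j := ⟨b₂, hB₂⟩) (by simpa using hne)

theorem IsIntermediateBasis.encard_inner_ne_zero_le_two {B : Set (F n k)}
    (hB : IsIntermediateBasis n k i B) (hi : i < n) {w : Word n k (i + 1)} {T : Chain n (i + 1)}
    {b : F n k} (hb : b ∈ gtSpace w T) : {b' ∈ B | inner ℂ b' b ≠ 0}.encard ≤ 2 := by
  have hlabel : ∀ b' ∈ B, ∃ (l : Letter) (w' : Word n k i) (T' : Chain n i),
      b' ∈ gtSpace w' T' ∧ w'.1 ⟨⟨i, hi⟩, le_rfl⟩ = l := fun b' hb' =>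
    let ⟨w', T', h⟩ := hB.mem_gtSpace b' hb'
    ⟨_, w', T', h, rfl⟩
  have : Nonempty Letter := ⟨Letter.one⟩
  choose! l hl using hlabel
  have hinj : Set.InjOn l {b' ∈ B | inner ℂ b' b ≠ 0} := by
    rintro b₁ ⟨hB₁, h₁⟩ b₂ ⟨hB₂, h₂⟩ h
    obtain ⟨w₁, T₁, hb₁, hw₁⟩ := hl b₁ hB₁
    obtain ⟨w₂, T₂, hb₂, hw₂⟩ := hl b₂ hB₂
    exact hB.eq_of_inner_ne_zero hi hb hb₁ hb₂ hB₁ hB₂ h₁ h₂ (hw₁.trans (h.trans hw₂.symm))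
  calc {b' ∈ B | inner ℂ b' b ≠ 0}.encard
      ≤ (Set.univ : Set Letter).encard :=
        Set.encard_le_encard_of_injOn (Set.mapsTo_univ _ _) hinj
    _ = 2 := by
        rw [Set.encard_univ, ENat.card_eq_coe_fintype_card]
        rfl

end GelfandTsetlinSpace

end Johnson

end

theorem mainTheorem2 (n k i : ℕ) (hi : i + 1 ≤ n)
    (B B' : Set (Johnson.F n k))
    (hB : Johnson.IsIntermediateBasis n k (i + 1) B)
    (hB' : Johnson.IsIntermediateBasis n k i B')
    (b : Johnson.F n k) (hb : b ∈ B) :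
    -- at most two elements of `B'` are not orthogonal to `b`
    {b' ∈ B' | inner ℂ b' b ≠ 0}.encard ≤ 2 ∧
    -- their labels agree with the label of `b`, the letter at the place `i + 1` excepted
    (∀ (w : Johnson.Word n k (i + 1)) (T : Johnson.Chain n (i + 1)),
      b ∈ Johnson.gtSpace w T →
      ∀ b' ∈ B', inner ℂ b' b ≠ 0 →
      ∀ (w' : Johnson.Word n k i) (T' : Johnson.Chain n i),
        b' ∈ Johnson.gtSpace w' T' →
        T' = T.init ∧
        ∀ (j : Fin n) (hj : i + 1 ≤ (j : ℕ)), w'.1 ⟨j, Nat.le_of_succ_le hj⟩ = w.1 ⟨j, hj⟩) ∧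
    -- and they are determined by their letter at the place `i + 1`
    (∀ b₁ ∈ B', inner ℂ b₁ b ≠ 0 → ∀ b₂ ∈ B', inner ℂ b₂ b ≠ 0 →
      ∀ (w₁ w₂ : Johnson.Word n k i) (T₁ T₂ : Johnson.Chain n i),
        b₁ ∈ Johnson.gtSpace w₁ T₁ → b₂ ∈ Johnson.gtSpace w₂ T₂ →
        w₁.1 ⟨⟨i, hi⟩, le_rfl⟩ = w₂.1 ⟨⟨i, hi⟩, le_rfl⟩ → b₁ = b₂) := by
  obtain ⟨w, T, hbT⟩ := hB.mem_gtSpace b hb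
  refine ⟨hB'.encard_inner_ne_zero_le_two hi hbT, ?_, ?_⟩
  · intro w T hbT b' _ h w' T' hb'
    exact ⟨Johnson.chain_eq_init_of_inner_ne_zero hbT hb' h, fun j hj =>
      Johnson.word_apply_eq_of_inner_ne_zero hbT.2 hb'.2 h hj (Nat.le_of_succ_le hj)⟩
  · intro b₁ hB₁ h₁ b₂ hB₂ h₂ w₁ w₂ T₁ T₂ hb₁ hb₂ hw
    exact hB'.eq_of_inner_ne_zero hi hbT hb₁ hb₂ hB₁ hB₂ h₁ h₂ hw
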